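/- Let $X$ be a complex Hilbert space with scalar product $(\cdot,\cdot)$ (linear in the first argument), let $\mathcal D\subseteq X$ be a dense linear subspace, and let $a,b$ be positive semidefinite symmetric sesquilinear forms with common domain $\mathcal D$. Let $\alpha,\beta\ge 0$ be lower bounds of $a$ and $b$, respectively, i.e. $a(x,x)\ge\alpha\|x\|^2$ and $b(x,x)\ge\beta\|x\|^2$ for all $x\in\mathcal D$. Suppose that the form $a+b$ is closed, i.e. whenever $u_n\in\mathcal D$, $u_n\to x$ in $X$ and $(a+b)(u_n-u_m,u_n-u_m)\to 0$ as $n,m\to\infty$, then $x\in\mathcal D$ and $(a+b)(u_n-x,u_n-x)\to 0$. (Neither $a$ nor $b$ need be closed.) On $\mathcal D\oplus\mathcal D\subseteq X\oplus X$ consider the symmetric sesquilinear form $$h(x,y)=a(x_1,y_1)+b(x_2,y_1)+b(x_1,y_2)-a(x_2,y_2),\qquad x=\begin{bmatrix}x_1\\x_2\end{bmatrix},\ y=\begin{bmatrix}y_1\\y_2\end{bmatrix}.$$ Then there is a unique selfadjoint operator $H$ in the Hilbert space $X\oplus X$ such that $\mathcal D(H)\subseteq\mathcal D\oplus\mathcal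 D$ and $$h(x,y)=(Hx,y)\qquad\text{for all }x\in\mathcal D(H),\ y\in\mathcal D\oplus\mathcal D.$$ Moreover, if at least one of $\alpha,\beta$ is non-zero, then $H$ has a bounded, everywhere defined inverse, and $$\|H^{-1}\|\le\frac{1}{\sqrt{\alpha^2+\beta^2}}.$$ -/

import Mathlib

open Filter Topology

namespace BlockForm

section Forms

variable {X : Type*} [NormedAddCommGroup X] [InnerProductSpace ℂ X]

/-- Sesquilinear forms with domain `D`, a linear subspace of `X`: linear in the first argument,
conjugate-linear in the second. -/
abbrev SesqForm (D : Submodule ℂ X) : Type _ := D →ₗ[ℂ] D →ₗ⋆[ℂ] ℂ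

variable {D : Submodule ℂ X}

/-- The form is symmetric (Hermitian). -/
def IsSymmetric (t : SesqForm D) : Prop :=
  ∀ x y : D, t x y = starRingEnd ℂ (t y x)

/-- `γ` is a lower bound of the symmetric form `t`: `t(x, x) ≥ γ ‖x‖²` on the domain.
For a symmetric form, `t(x, x)` is real. -/
def HasLowerBound (t : SesqForm D) (γ : ℝ) : Prop :=
  ∀ x : D, γ * ‖(x : X)‖ ^ 2 ≤ (t x x).re

/-- The form is positive semidefinite. -/
def IsPosSemidef (t : SesqForm D) : Prop :=
  ∀ x : D, 0 ≤ (t x x).re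

/-- Closedness of a positive semidefinite symmetric form: if `uₙ ∈ D`, `uₙ → x` in `X` and
`t(uₙ - uₘ, uₙ - uₘ) → 0` as `n, m → ∞`, then `x ∈ D` and `t(uₙ - x, uₙ - x) → 0`. -/
def IsClosedForm (t : SesqForm D) : Prop :=
  ∀ (u : ℕ → D) (x : X),
    Tendsto (fun n => (u n : X)) atTop (𝓝 x) →
    Tendsto (fun p : ℕ × ℕ => t (u p.1 - u p.2) (u p.1 - u p.2)) atTop (𝓝 0) →
    ∃ hx : x ∈ D, Tendsto (fun n => t (u n - ⟨x, hx⟩) (u n - ⟨x, hx⟩)) atTop (𝓝 0)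

/-- The operator `T` (with its own domain) is represented by the form `t`: its domain is contained
in that of `t`, and `t(x, y) = (T x, y)` for all `x` in the domain of `T` and `y` in the domain of
`t`. The scalar product `(u, v)`, linear in `u`, is `inner ℂ v u` here. -/
def Represents (t : SesqForm D) (T : X →ₗ.[ℂ] X) : Prop :=
  ∃ hle : T.domain ≤ D, ∀ (x : T.domain) (y : D),
    t ⟨(x : X), hle x.2⟩ y = inner ℂ (y : X) (T x)

/-- The bounded everywhere defined operator `R` is the inverse of the operator `T`. -/
def IsBoundedInverse (T : X →ₗ.[ℂ] X) (R : X →L[ℂ] X) : Prop :=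
  (∀ u : X, ∃ hu : R u ∈ T.domain, T ⟨R u, hu⟩ = u) ∧
    ∀ x : T.domain, R (T x) = (x : X)

end Forms

section Block

variable {X : Type*} [NormedAddCommGroup X] [InnerProductSpace ℂ X]

/-- The subspace `D ⊕ D` of the Hilbert space sum `X ⊕ X`. -/
def sumDomain (D : Submodule ℂ X) : Submodule ℂ (WithLp 2 (X × X)) where
  carrier := {x | x.fst ∈ D ∧ x.snd ∈ D}
  zero_mem' := ⟨D.zero_mem, D.zero_mem⟩
  add_mem' := fun hx hy => ⟨D.add_mem hx.1 hy.1, D.add_mem hx.2 hy.2⟩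
  smul_mem' := fun c _ hx => ⟨D.smul_mem c hx.1, D.smul_mem c hx.2⟩

/-- First component `D ⊕ D → D`. -/
def comp₁ (D : Submodule ℂ X) : sumDomain D →ₗ[ℂ] D where
  toFun x := ⟨(x : WithLp 2 (X × X)).fst, x.2.1⟩
  map_add' _ _ := rfl
  map_smul' _ _ := rfl

/-- Second component `D ⊕ D → D`. -/
def comp₂ (D : Submodule ℂ X) : sumDomain D →ₗ[ℂ] D where
  toFun x := ⟨(x : WithLp 2 (X × X)).snd, x.2.2⟩
  map_add' _ _ := rfl
  map_smul' _ _ := rfl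

variable {D : Submodule ℂ X}

/-- The block form `h` on `D ⊕ D`. -/
noncomputable def blockForm (a b : SesqForm D) : SesqForm (sumDomain D) :=
  LinearMap.mk₂'ₛₗ (RingHom.id ℂ) (starRingEnd ℂ)
    (fun x y => a (comp₁ D x) (comp₁ D y) + b (comp₂ D x) (comp₁ D y)
      + b (comp₁ D x) (comp₂ D y) - a (comp₂ D x) (comp₂ D y))
    (fun x x' y => by simp only [map_add, LinearMap.add_apply]; ring)
    (fun c x y => by
      simp only [map_smul, LinearMap.smul_apply, smul_eq_mul, RingHom.id_apply]; ring)
    (fun x y y' => by simp only [map_add]; ring)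
    (fun c x y => by simp only [map_smul, LinearMap.map_smulₛₗ, smul_eq_mul]; ring)

theorem blockForm_apply (a b : SesqForm D) (x y : sumDomain D) :
    blockForm a b x y = a (comp₁ D x) (comp₁ D y) + b (comp₂ D x) (comp₁ D y)
      + b (comp₁ D x) (comp₂ D y) - a (comp₂ D x) (comp₂ D y) := rfl

end Block

end BlockForm

/-! Closedness makes `D`, with scalar product `(a + b)(x, y) + (x, y)`, a Hilbert space `V`, on
which `a` and `b` become bounded symmetric operators `A`, `B`. The block system with rows `(A, B)`
and `(B, -A)` is indefinite, but the sum and the difference of its rows form a coercive operator as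
soon as `A + B` is coercive, so it is solvable (`exists_block_solution`).

Replacing `a` by `a + (·,·)` gives this coercivity and changes `h` only by the bounded reflection `K
= diag(1, -1)`. Hence `H + K` is onto, where `H` is the largest operator represented by `h`, and a
symmetric operator with this property is selfadjoint. Any other selfadjoint operator represented by
`h` has the same graph.

Testing `h(x, ·)` against a rotated and scaled copy of `x` gives `√(α² + β²) ‖x‖ ≤ ‖H x‖`. If `α + β
> 0`, then `A + B` is already coercive without the shift, so `H` is onto. -/

namespace BlockForm

/-! ### Bounded forms and a block system on a Hilbert space -/

section Inequality

variable {V : Type*} [AddCommGroup V] [Module ℂ V]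

/-- The Cauchy-Schwarz inequality for positive semidefinite symmetric sesquilinear forms. -/
theorem norm_sq_le_of_posSemidef (s : V →ₗ[ℂ] V →ₗ⋆[ℂ] ℂ)
    (hs : ∀ x y, s x y = starRingEnd ℂ (s y x)) (h0 : ∀ x, 0 ≤ (s x x).re) (x y : V) :
    ‖s x y‖ ^ 2 ≤ (s x x).re * (s y y).re := by
  let c : PreInnerProductSpace.Core ℂ V :=
    { inner := fun x y => s y x
      conj_inner_symm := fun x y => (hs y x).symm
      re_inner_nonneg := fun x => h0 x
      add_left := fun x y z => by simp
      smul_left := fun x y r => by simp }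
  have h := @InnerProductSpace.Core.inner_mul_inner_self_le ℂ V _ _ _ c x y
  have h' : ‖s y x‖ * ‖s x y‖ ≤ (s x x).re * (s y y).re := h
  rwa [hs y x, RCLike.norm_conj, ← sq] at h'

end Inequality

section Hilbert

variable {V : Type*} [NormedAddCommGroup V] [InnerProductSpace ℂ V] [CompleteSpace V]

/-- A positive semidefinite symmetric form that is bounded by the squared norm is represented by a
bounded operator. -/
theorem exists_continuousLinearMap_of_form (s : V →ₗ[ℂ] V →ₗ⋆[ℂ] ℂ)
    (hs : ∀ x y, s x y = starRingEnd ℂ (s y x)) (h0 : ∀ x, 0 ≤ (s x x).re)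
    (h1 : ∀ x, (s x x).re ≤ ‖x‖ ^ 2) :
    ∃ A : V →L[ℂ] V, ∀ x y, inner ℂ (A x) y = s y x := by
  have hb : ∀ x y, ‖s.flip x y‖ ≤ 1 * ‖x‖ * ‖y‖ := fun x y => by
    rw [one_mul, LinearMap.flip_apply]
    refine abs_le_of_sq_le_sq' ?_ (by positivity) |>.2
    refine (norm_sq_le_of_posSemidef s hs h0 y x).trans ?_
    rw [mul_pow, mul_comm]
    exact mul_le_mul (h1 x) (h1 y) (h0 y) (by positivity)
  exact ⟨InnerProductSpace.continuousLinearMapOfBilin (s.flip.mkContinuous₂ 1 hb), fun x y => by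
    simp⟩

/-- Solvability of the block system with bounded symmetric `A`, `B` and coercive `A + B`. -/
theorem exists_block_solution (A B : V →L[ℂ] V)
    (hA : ∀ x y, inner ℂ (A x) y = inner ℂ x (A y))
    (hB : ∀ x y, inner ℂ (B x) y = inner ℂ x (B y))
    {c : ℝ} (hc : 0 < c)
    (h : ∀ x, c * ‖x‖ ^ 2 ≤ (inner ℂ (A x) x + inner ℂ (B x) x : ℂ).re) (f g : V) :
    ∃ u v : V, A u + B v = f ∧ B u - A v = g := by
  let E := WithLp 2 (V × V)
  let p₁ : E →L[ℂ] V := WithLp.fstL 2 ℂ V V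
  let p₂ : E →L[ℂ] V := WithLp.sndL 2 ℂ V V
  let T₁ : E →L[ℂ] V := A ∘L p₁ + B ∘L p₂
  let T₂ : E →L[ℂ] V := B ∘L p₁ - A ∘L p₂
  -- Sum and difference of the two rows: by symmetry the mixed terms in `Re (T w, w)` cancel,
  -- leaving `((A + B) w₁, w₁) + ((A + B) w₂, w₂)`.
  let T : E →L[ℂ] E :=
    (WithLp.prodContinuousLinearEquiv 2 ℂ V V).symm.toContinuousLinearMap ∘L
      ((T₁ + T₂).prod (T₁ - T₂))
  have hT₁ : ∀ w : E, T₁ w = A w.fst + B w.snd := fun w => rfl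
  have hT₂ : ∀ w : E, T₂ w = B w.fst - A w.snd := fun w => rfl
  have hT : ∀ w : E, T w = WithLp.toLp 2 (T₁ w + T₂ w, T₁ w - T₂ w) := fun w => rfl
  have hu : IsUnit T := by
    refine ContinuousLinearMap.isUnit_of_forall_le_norm_inner_map T (c := ⟨c, hc.le⟩) hc
      fun w => ?_
    refine le_trans ?_ (Complex.re_le_norm _)
    have e1 := h w.fst
    have e2 := h w.snd
    have cA : (inner ℂ (A w.snd) w.fst : ℂ).re = (inner ℂ (A w.fst) w.snd : ℂ).re := by
      rw [hA, ← inner_conj_symm, Complex.conj_re]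
    have cB : (inner ℂ (B w.snd) w.fst : ℂ).re = (inner ℂ (B w.fst) w.snd : ℂ).re := by
      rw [hB, ← inner_conj_symm, Complex.conj_re]
    rw [hT, hT₁, hT₂, WithLp.prod_inner_apply, WithLp.prod_norm_sq_eq_of_L2]
    simp only [inner_add_left, inner_sub_left, Complex.add_re, Complex.sub_re] at e1 e2 ⊢
    change (‖w.fst‖ ^ 2 + ‖w.snd‖ ^ 2) * c ≤
      (inner ℂ (A w.fst) w.fst).re + (inner ℂ (B w.snd) w.fst).re
          + ((inner ℂ (B w.fst) w.fst).re - (inner ℂ (A w.snd) w.fst).re)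
        + ((inner ℂ (A w.fst) w.snd).re + (inner ℂ (B w.snd) w.snd).re
          - ((inner ℂ (B w.fst) w.snd).re - (inner ℂ (A w.snd) w.snd).re))
    linarith
  obtain ⟨w, hw⟩ := (ContinuousLinearMap.isUnit_iff_bijective.mp hu).2 (WithLp.toLp 2 (f + g, f - g))
  have h1 : T₁ w + T₂ w = f + g := congrArg WithLp.fst hw
  have h2 : T₁ w - T₂ w = f - g := congrArg WithLp.snd hw
  have hs : (2 : ℂ) • T₁ w = (2 : ℂ) • f := by
    rw [two_smul, two_smul]
    calc T₁ w + T₁ w = (T₁ w + T₂ w) + (T₁ w - T₂ w) := by abel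
      _ = f + f := by rw [h1, h2]; abel
  have h3 : T₁ w = f := smul_right_injective V (two_ne_zero' ℂ) hs
  exact ⟨w.fst, w.snd, h3, by rw [h3] at h1; exact add_left_cancel h1⟩

end Hilbert

/-! ### The Hilbert space of a closed form -/

section FormDomain

variable {X : Type*} [NormedAddCommGroup X] [InnerProductSpace ℂ X] {D : Submodule ℂ X}

/-- The domain of a positive semidefinite symmetric form `t`, to be equipped with the scalar product
of the form plus that of the ambient space. -/
def FormDomain (t : SesqForm D) (_ : IsSymmetric t) (_ : IsPosSemidef t) : Type _ := D

namespace FormDomain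

variable {t : SesqForm D} {ht : IsSymmetric t} {h0 : IsPosSemidef t}

instance : AddCommGroup (FormDomain t ht h0) := inferInstanceAs (AddCommGroup D)

instance : Module ℂ (FormDomain t ht h0) := inferInstanceAs (Module ℂ D)

/-- The identification of the form domain with the underlying subspace. -/
def toDomain (t : SesqForm D) (ht : IsSymmetric t) (h0 : IsPosSemidef t) :
    FormDomain t ht h0 ≃ₗ[ℂ] D :=
  LinearEquiv.refl ℂ D

/-- The scalar product on the form domain. -/
noncomputable abbrev core (t : SesqForm D) (ht : IsSymmetric t) (h0 : IsPosSemidef t) :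
    InnerProductSpace.Core ℂ (FormDomain t ht h0) where
  inner x y := t (toDomain t ht h0 y) (toDomain t ht h0 x)
    + inner ℂ (toDomain t ht h0 x : X) (toDomain t ht h0 y : X)
  conj_inner_symm x y := by
    rw [map_add, ← ht, inner_conj_symm]
  re_inner_nonneg x := add_nonneg (h0 _) (inner_self_nonneg (𝕜 := ℂ))
  add_left x y z := by
    simp only [map_add, Submodule.coe_add, inner_add_left]; ring
  smul_left x y r := by
    simp only [map_smul, LinearMap.map_smulₛₗ, Submodule.coe_smul, inner_smul_left, smul_eq_mul]
    ring
  definite x hx := by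
    have h1 := h0 (toDomain t ht h0 x)
    have h2 : ‖(toDomain t ht h0 x : X)‖ ^ 2 = 0 := by
      have h3 := congrArg Complex.re hx
      rw [Complex.add_re, Complex.zero_re] at h3
      have h4 := norm_sq_eq_re_inner (𝕜 := ℂ) (toDomain t ht h0 x : X)
      have h5 : 0 ≤ ‖(toDomain t ht h0 x : X)‖ ^ 2 := by positivity
      simp only [RCLike.re_to_complex] at h4
      linarith
    exact Subtype.ext (norm_eq_zero.mp (pow_eq_zero_iff two_ne_zero |>.mp h2))

noncomputable instance : NormedAddCommGroup (FormDomain t ht h0) :=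
  (core t ht h0).toNormedAddCommGroup

noncomputable instance : InnerProductSpace ℂ (FormDomain t ht h0) :=
  InnerProductSpace.ofCore (core t ht h0).toCore

theorem norm_sq (x : FormDomain t ht h0) :
    ‖x‖ ^ 2 = (t (toDomain t ht h0 x) (toDomain t ht h0 x)).re + ‖(toDomain t ht h0 x : X)‖ ^ 2 := by
  rw [norm_sq_eq_re_inner (𝕜 := ℂ) x, norm_sq_eq_re_inner (𝕜 := ℂ) (toDomain t ht h0 x : X)]
  rfl

theorem norm_coe_le (x : FormDomain t ht h0) : ‖(toDomain t ht h0 x : X)‖ ≤ ‖x‖ := by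
  refine abs_le_of_sq_le_sq' ?_ (norm_nonneg x) |>.2
  rw [norm_sq]
  exact le_add_of_nonneg_left (h0 _)

/-- The continuous embedding of the form domain into the ambient space. -/
noncomputable def embedding (t : SesqForm D) (ht : IsSymmetric t) (h0 : IsPosSemidef t) :
    FormDomain t ht h0 →L[ℂ] X :=
  LinearMap.mkContinuous (D.subtype ∘ₗ (toDomain t ht h0).toLinearMap) 1 fun x => by
    rw [one_mul]; exact norm_coe_le x

theorem apply_self_eq_re (ht : IsSymmetric t) (x : D) : t x x = ((t x x).re : ℂ) :=
  (Complex.conj_eq_iff_re.mp (ht x x).symm).symm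

/-- The form norm dominates both the norm of `X` and `t`, so a Cauchy sequence has a limit in `X`;
closedness puts it in `D` and yields convergence in `t` as well. -/
theorem completeSpace [CompleteSpace X] (hc : IsClosedForm t) :
    CompleteSpace (FormDomain t ht h0) := by
  refine Metric.complete_of_cauchySeq_tendsto fun u hu => ?_
  have hX : CauchySeq fun n => embedding t ht h0 (u n) :=
    hu.map (embedding t ht h0).uniformContinuous
  obtain ⟨x, hx⟩ := cauchySeq_tendsto_of_complete hX
  have hform : Tendsto (fun p : ℕ × ℕ =>
      t (toDomain t ht h0 (u p.1) - toDomain t ht h0 (u p.2))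
        (toDomain t ht h0 (u p.1) - toDomain t ht h0 (u p.2))) atTop (𝓝 0) := by
    have hd : Tendsto (fun p : ℕ × ℕ => ‖u p.1 - u p.2‖ ^ 2) atTop (𝓝 0) := by
      have := (cauchySeq_iff_tendsto_dist_atTop_0.mp hu).pow 2
      simpa [dist_eq_norm] using this
    refine squeeze_zero_norm (fun p => ?_) hd
    rw [← map_sub, apply_self_eq_re ht, Complex.norm_real, Real.norm_of_nonneg (h0 _), norm_sq]
    exact le_add_of_nonneg_right (by positivity)
  obtain ⟨hxD, hlim⟩ := hc (fun n => toDomain t ht h0 (u n)) x hx hform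
  refine ⟨(toDomain t ht h0).symm ⟨x, hxD⟩, ?_⟩
  rw [tendsto_iff_norm_sub_tendsto_zero]
  have hsq : Tendsto (fun n => ‖u n - (toDomain t ht h0).symm ⟨x, hxD⟩‖ ^ 2) atTop (𝓝 0) := by
    have h1 := (Complex.continuous_re.tendsto _).comp hlim
    have h2 := (tendsto_iff_norm_sub_tendsto_zero.mp hx).pow 2
    have h3 := h1.add h2
    simp only [Complex.zero_re, zero_pow two_ne_zero, add_zero] at h3
    refine h3.congr fun n => ?_
    rw [norm_sq, map_sub, LinearEquiv.apply_symm_apply]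
    rfl
  have := hsq.sqrt
  simpa [Real.sqrt_sq (norm_nonneg _)] using this

end FormDomain

/-- Solvability of the weak block equation for forms that are bounded relative to a closed form `t`
and whose sum is coercive relative to it. -/
theorem exists_weak_block_solution [CompleteSpace X] {t a b : SesqForm D} (ht : IsSymmetric t)
    (ht0 : IsPosSemidef t) (hc : IsClosedForm t) (ha : IsSymmetric a) (hb : IsSymmetric b)
    (ha0 : IsPosSemidef a) (hb0 : IsPosSemidef b)
    (hat : ∀ x : D, (a x x).re ≤ (t x x).re + ‖(x : X)‖ ^ 2)
    (hbt : ∀ x : D, (b x x).re ≤ (t x x).re + ‖(x : X)‖ ^ 2)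
    {δ : ℝ} (hδ : 0 < δ)
    (hab : ∀ x : D, δ * ((t x x).re + ‖(x : X)‖ ^ 2) ≤ (a x x).re + (b x x).re) (z₁ z₂ : X) :
    ∃ w₁ w₂ : D, (∀ y : D, a w₁ y + b w₂ y = inner ℂ (y : X) z₁) ∧
      ∀ y : D, b w₁ y - a w₂ y = inner ℂ (y : X) z₂ := by
  let V := FormDomain t ht ht0
  let e : V ≃ₗ[ℂ] D := FormDomain.toDomain t ht ht0
  let j : V →L[ℂ] X := FormDomain.embedding t ht ht0
  have : CompleteSpace V := FormDomain.completeSpace hc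
  have key : ∀ s : SesqForm D, IsSymmetric s → IsPosSemidef s →
      (∀ x : D, (s x x).re ≤ (t x x).re + ‖(x : X)‖ ^ 2) →
      ∃ A : V →L[ℂ] V, ∀ x y, inner ℂ (A x) y = s (e y) (e x) := fun s hs hs0 hst =>
    exists_continuousLinearMap_of_form (V := V) s hs hs0 fun x =>
      (hst x).trans_eq (FormDomain.norm_sq (ht := ht) (h0 := ht0) x).symm
  have symm : ∀ s : SesqForm D, IsSymmetric s → ∀ A : V →L[ℂ] V,
      (∀ x y, inner ℂ (A x) y = s (e y) (e x)) → ∀ x y, inner ℂ (A x) y = inner ℂ x (A y) :=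
    fun s hs A hA x y => by rw [← inner_conj_symm x, hA, hA, hs]
  obtain ⟨A, hA⟩ := key a ha ha0 hat
  obtain ⟨B, hB⟩ := key b hb hb0 hbt
  obtain ⟨u, v, h1, h2⟩ := exists_block_solution A B (symm a ha A hA) (symm b hb B hB) hδ
    (fun x => by
      rw [hA, hB, Complex.add_re, FormDomain.norm_sq]
      exact hab _) (ContinuousLinearMap.adjoint j z₁) (ContinuousLinearMap.adjoint j z₂)
  have conj : ∀ s : SesqForm D, IsSymmetric s → ∀ A : V →L[ℂ] V,
      (∀ x y, inner ℂ (A x) y = s (e y) (e x)) → ∀ x y, s (e x) y = inner ℂ (e.symm y) (A x) :=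
    fun s hs A hA x y => by rw [← inner_conj_symm, hA, LinearEquiv.apply_symm_apply, ← hs]
  refine ⟨e u, e v, fun y => ?_, fun y => ?_⟩
  · rw [conj a ha A hA, conj b hb B hB, ← inner_add_right, h1,
      ContinuousLinearMap.adjoint_inner_right]
    rfl
  · rw [conj a ha A hA, conj b hb B hB, ← inner_sub_right, h2,
      ContinuousLinearMap.adjoint_inner_right]
    rfl

end FormDomain

/-! ### Selfadjoint operators from symmetric forms -/

section SelfAdjoint

variable {E : Type*} [NormedAddCommGroup E] [InnerProductSpace ℂ E] {D : Submodule ℂ E}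

/-- The graph of the largest operator represented by the form `q`. -/
def formGraph (q : SesqForm D) : Submodule ℂ (E × E) where
  carrier := {p | ∃ x : D, (x : E) = p.1 ∧ ∀ y : D, q x y = inner ℂ (y : E) p.2}
  zero_mem' := ⟨0, rfl, fun y => by simp⟩
  add_mem' := by
    rintro p p' ⟨x, hx, h⟩ ⟨x', hx', h'⟩
    exact ⟨x + x', by simp [hx, hx'], fun y => by simp [h, h']⟩
  smul_mem' := by
    rintro c p ⟨x, hx, h⟩
    exact ⟨c • x, by simp [hx], fun y => by simp [h]⟩

theorem mem_formGraph_coe {q : SesqForm D} {x : D} {z : E} :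
    ((x : E), z) ∈ formGraph q ↔ ∀ y : D, q x y = inner ℂ (y : E) z := by
  refine ⟨?_, fun h => ⟨x, rfl, h⟩⟩
  rintro ⟨x', hx', h⟩
  rwa [Subtype.ext hx'] at h

theorem graph_le_formGraph {q : SesqForm D} {H : E →ₗ.[ℂ] E} (hq : Represents q H) :
    H.graph ≤ formGraph q := by
  rintro ⟨x, z⟩ hp
  obtain ⟨w, hw, hw'⟩ := LinearPMap.mem_graph_iff H |>.mp hp
  obtain ⟨hle, h⟩ := hq
  exact ⟨⟨w, hle w.2⟩, hw, fun y => by rw [h w y, hw']⟩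

variable [CompleteSpace E]

/-- A selfadjoint operator represented by a symmetric form is the largest operator represented by
it. -/
theorem graph_eq_formGraph {q : SesqForm D} (hs : IsSymmetric q) {H : E →ₗ.[ℂ] E}
    (hH : IsSelfAdjoint H) (hq : Represents q H) : H.graph = formGraph q := by
  refine le_antisymm (graph_le_formGraph hq) ?_
  rintro ⟨x, z⟩ ⟨w, hw, h⟩
  dsimp only at hw h
  subst hw
  obtain ⟨hle, hr⟩ := hq
  -- This says that `w` lies in the domain of the adjoint, with value `z`; the adjoint is `H`
  -- itself.
  have key : ∀ v : H.domain, inner ℂ z (v : E) = inner ℂ (w : E) (H v) := fun v => by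
    rw [← hr v w, hs, h ⟨v, hle v.2⟩, inner_conj_symm]
  have hd := hH.dense_domain
  rw [← LinearPMap.isSelfAdjoint_def.mp hH]
  exact LinearPMap.mem_graph_iff _ |>.mpr
    ⟨⟨w, LinearPMap.mem_adjoint_domain_of_exists _ ⟨z, key⟩⟩, rfl,
      LinearPMap.adjoint_apply_eq hd _ key⟩

/-- A densely defined symmetric form that becomes surjective after a bounded symmetric perturbation
represents a unique selfadjoint operator. -/
theorem existsUnique_isSelfAdjoint_represents (hD : Dense (D : Set E)) {q : SesqForm D}
    (hs : IsSymmetric q) {K : E → E}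
    (hK : ∀ x y, inner ℂ (K x) y = inner ℂ x (K y))
    (hsurj : ∀ z : E, ∃ w : D, ∀ y : D, q w y + inner ℂ (y : E) (K w) = inner ℂ (y : E) z) :
    ∃! H : E →ₗ.[ℂ] E, IsSelfAdjoint H ∧ Represents q H := by
  -- Density of `D` makes the graph single-valued.
  have hg : ∀ p ∈ formGraph q, p.1 = 0 → p.2 = 0 := by
    rintro ⟨x, z⟩ ⟨w, hw, h⟩ (rfl : x = 0)
    obtain rfl : w = 0 := Subtype.ext hw
    exact hD.eq_zero_of_inner_right ℂ fun v hv => by simpa using (h ⟨v, hv⟩).symm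
  let H := (formGraph q).toLinearPMap
  have hgr : H.graph = formGraph q := Submodule.toLinearPMap_graph_eq _ hg
  have hmem : ∀ x : H.domain, ∃ w : D, (w : E) = x ∧ ∀ y : D, q w y = inner ℂ (y : E) (H x) :=
    fun x => by
      have : ((x : E), H x) ∈ formGraph q := hgr ▸ H.mem_graph x
      exact this
  have hrep : Represents q H := by
    refine ⟨fun x hx => ?_, fun x y => ?_⟩
    · obtain ⟨w, hw, -⟩ := hmem ⟨x, hx⟩
      rw [show x = w from hw.symm]
      exact w.2
    · obtain ⟨w, hw, h⟩ := hmem x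
      have e : ∀ hx : (x : E) ∈ D, (⟨x, hx⟩ : D) = w := fun _ => Subtype.ext hw.symm
      rw [e]
      exact h y
  obtain ⟨hle, hr⟩ := id hrep
  have hsol : ∀ z : E, ∃ w : H.domain, H w + K w = z := fun z => by
    obtain ⟨w, h⟩ := hsurj z
    have : ((w : E), z - K w) ∈ H.graph := by
      rw [hgr, mem_formGraph_coe]
      intro y
      rw [inner_sub_right, ← h y, add_sub_cancel_right]
    obtain ⟨v, hv, hv'⟩ := LinearPMap.mem_graph_iff H |>.mp this
    dsimp only at hv hv'
    exact ⟨v, by rw [hv', hv, sub_add_cancel]⟩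
  have hsymm : H.IsFormalAdjoint H := fun x y => by
    rw [← hr y ⟨x, hle x.2⟩, hs, hr x ⟨y, hle y.2⟩, inner_conj_symm]
  have hdense : Dense (H.domain : Set E) := by
    rw [Submodule.dense_iff_topologicalClosure_eq_top, Submodule.topologicalClosure_eq_top_iff,
      Submodule.eq_bot_iff]
    -- Write `z = (H + K) w`. By symmetry `w` is orthogonal to the range of `H + K`, which is
    -- everything.
    intro z hz
    obtain ⟨w, rfl⟩ := hsol z
    have hw : (w : E) = 0 := by
      refine ext_inner_right ℂ fun u => ?_
      obtain ⟨x, rfl⟩ := hsol u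
      rw [inner_zero_left, inner_add_right, ← hsymm, ← hK, ← inner_add_left]
      exact Submodule.inner_left_of_mem_orthogonal x.2 hz
    obtain rfl : w = 0 := Subtype.ext hw
    -- `K` is a bare function, so `K 0 = 0` has to come from symmetry.
    have hK0 : K 0 = 0 := ext_inner_right ℂ fun u => by rw [hK, inner_zero_left, inner_zero_left]
    simp [hK0]
  have hself : IsSelfAdjoint H := by
    rw [LinearPMap.isSelfAdjoint_def]
    refine le_antisymm ?_ (hsymm.le_adjoint hdense)
    refine LinearPMap.le_of_le_graph ?_
    rintro ⟨x, z⟩ hp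
    obtain ⟨v, hv, hv'⟩ := LinearPMap.mem_graph_iff _ |>.mp hp
    dsimp only at hv hv'
    subst hv hv'
    have hadj := LinearPMap.adjoint_isFormalAdjoint hdense v
    -- Then `v - w` is orthogonal to the range of `H + K`, so `v = w` lies in the domain of `H`.
    obtain ⟨w, hw⟩ := hsol (H.adjoint v + K v)
    have hvw : (v : E) = w := by
      refine ext_inner_right ℂ fun u => ?_
      obtain ⟨x, rfl⟩ := hsol u
      rw [inner_add_right, inner_add_right, ← hadj, ← hsymm, ← hK, ← hK, ← inner_add_left,
        ← inner_add_left, hw]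
    refine LinearPMap.mem_graph_iff H |>.mpr ⟨w, hvw.symm, ?_⟩
    rw [hvw] at hw
    exact add_right_cancel hw
  refine ⟨H, ⟨hself, hrep⟩, fun H' hH' => LinearPMap.eq_of_eq_graph ?_⟩
  rw [hgr, graph_eq_formGraph hs hH'.1 hH'.2]

end SelfAdjoint

/-- A surjective operator that is bounded below has a bounded inverse. -/
theorem exists_isBoundedInverse {E : Type*} [NormedAddCommGroup E] [InnerProductSpace ℂ E]
    (H : E →ₗ.[ℂ] E) {γ : ℝ} (hγ : 0 < γ) (hbelow : ∀ x : H.domain, γ * ‖(x : E)‖ ≤ ‖H x‖)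
    (hsurj : ∀ z : E, ∃ x : H.domain, H x = z) :
    ∃ R : E →L[ℂ] E, IsBoundedInverse H R ∧ ‖R‖ ≤ 1 / γ := by
  have hinj : Function.Injective H.toFun := by
    refine (injective_iff_map_eq_zero _).mpr fun x hx => ?_
    have h := hbelow x
    rw [show H x = 0 from hx, norm_zero] at h
    exact Subtype.ext (norm_le_zero_iff.mp (nonpos_of_mul_nonpos_right h hγ))
  let e := LinearEquiv.ofBijective H.toFun ⟨hinj, hsurj⟩
  have he : ∀ z, H (e.symm z) = z := fun z => e.apply_symm_apply z
  refine ⟨LinearMap.mkContinuous (H.domain.subtype ∘ₗ e.symm.toLinearMap) (1 / γ) fun z => ?_,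
    ⟨fun u => ⟨(e.symm u).2, he u⟩, fun x => ?_⟩, LinearMap.mkContinuous_norm_le _ (by positivity) _⟩
  · have h := hbelow (e.symm z)
    rw [he] at h
    rw [one_div, inv_mul_eq_div, le_div_iff₀ hγ, mul_comm]
    exact h
  · exact congrArg Subtype.val (e.symm_apply_apply x)

/-! ### The block form: solvability and lower bound -/

section Block

variable {X : Type*} [NormedAddCommGroup X] [InnerProductSpace ℂ X] {D : Submodule ℂ X}

/-- The ambient scalar product as a form on `D`. -/
noncomputable def innerForm (D : Submodule ℂ X) : SesqForm D :=
  LinearMap.mk₂'ₛₗ (RingHom.id ℂ) (starRingEnd ℂ) (fun x y => inner ℂ (y : X) (x : X))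
    (fun x x' y => by simp) (fun c x y => by simp)
    (fun x y y' => by simp) (fun c x y => by simp [mul_comm])

theorem innerForm_apply (x y : D) : innerForm D x y = inner ℂ (y : X) (x : X) := rfl

theorem isSymmetric_innerForm : IsSymmetric (innerForm D) := fun x y =>
  (inner_conj_symm (y : X) (x : X)).symm

theorem innerForm_self_re (x : D) : (innerForm D x x).re = ‖(x : X)‖ ^ 2 :=
  (norm_sq_eq_re_inner (𝕜 := ℂ) (x : X)).symm

theorem isPosSemidef_innerForm : IsPosSemidef (innerForm D) := fun x => by
  rw [innerForm_self_re]; positivity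

theorem IsSymmetric.add {s t : SesqForm D} (hs : IsSymmetric s) (ht : IsSymmetric t) :
    IsSymmetric (s + t) := fun x y => by
  simp only [LinearMap.add_apply, map_add]
  rw [hs x y, ht x y]

theorem IsPosSemidef.add {s t : SesqForm D} (hs : IsPosSemidef s) (ht : IsPosSemidef t) :
    IsPosSemidef (s + t) := fun x => add_nonneg (hs x) (ht x)

theorem add_self_re (s t : SesqForm D) (x : D) :
    ((s + t) x x).re = (s x x).re + (t x x).re := rfl

theorem isSymmetric_blockForm {a b : SesqForm D} (ha : IsSymmetric a) (hb : IsSymmetric b) :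
    IsSymmetric (blockForm a b) := fun x y => by
  rw [blockForm_apply, blockForm_apply]
  simp only [map_add, map_sub]
  rw [← ha, ← ha, ← hb, ← hb]
  ring

theorem dense_sumDomain (hD : Dense (D : Set X)) :
    Dense (sumDomain D : Set (WithLp 2 (X × X))) :=
  (hD.prod hD).preimage (WithLp.homeomorphProd 2 X X).isOpenMap

/-- The element of `D ⊕ D` with given components. -/
def sumMk (x₁ x₂ : D) : sumDomain D := ⟨WithLp.toLp 2 ((x₁ : X), (x₂ : X)), x₁.2, x₂.2⟩

theorem comp₁_sumMk (x₁ x₂ : D) : comp₁ D (sumMk x₁ x₂) = x₁ := rfl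

theorem comp₂_sumMk (x₁ x₂ : D) : comp₂ D (sumMk x₁ x₂) = x₂ := rfl

theorem norm_sq_sumDomain (x : sumDomain D) :
    ‖(x : WithLp 2 (X × X))‖ ^ 2 = ‖(comp₁ D x : X)‖ ^ 2 + ‖(comp₂ D x : X)‖ ^ 2 :=
  WithLp.prod_norm_sq_eq_of_L2 _

theorem inner_sumDomain (y : sumDomain D) (z : WithLp 2 (X × X)) :
    inner ℂ (y : WithLp 2 (X × X)) z
      = inner ℂ (comp₁ D y : X) z.fst + inner ℂ (comp₂ D y : X) z.snd :=
  WithLp.prod_inner_apply _ _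

/-- The reflection `diag(1, -1)` of `X ⊕ X`. -/
def reflection (x : WithLp 2 (X × X)) : WithLp 2 (X × X) := WithLp.toLp 2 (x.fst, -x.snd)

theorem inner_reflection_left (x y : WithLp 2 (X × X)) :
    inner ℂ (reflection x) y = inner ℂ x (reflection y) := by
  simp [reflection, WithLp.prod_inner_apply]

theorem blockForm_eq_inner {a b : SesqForm D} {w₁ w₂ : D} {z : WithLp 2 (X × X)}
    (h₁ : ∀ y : D, a w₁ y + b w₂ y = inner ℂ (y : X) z.fst)
    (h₂ : ∀ y : D, b w₁ y - a w₂ y = inner ℂ (y : X) z.snd) (y : sumDomain D) :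
    blockForm a b (sumMk w₁ w₂) y = inner ℂ (y : WithLp 2 (X × X)) z := by
  rw [blockForm_apply, inner_sumDomain, ← h₁, ← h₂, comp₁_sumMk, comp₂_sumMk]
  ring

/-- Lets the shift that makes `a + b` coercive be read as a bounded symmetric perturbation of `h`.
-/
theorem blockForm_add_innerForm (a b : SesqForm D) (x y : sumDomain D) :
    blockForm (a + innerForm D) b x y
      = blockForm a b x y
        + inner ℂ (y : WithLp 2 (X × X)) (reflection (x : WithLp 2 (X × X))) := by
  rw [blockForm_apply, blockForm_apply, inner_sumDomain]
  have e₁ : (reflection (x : WithLp 2 (X × X))).fst = (comp₁ D x : X) := rfl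
  have e₂ : (reflection (x : WithLp 2 (X × X))).snd = -(comp₂ D x : X) := rfl
  simp only [e₁, e₂, LinearMap.add_apply, innerForm_apply, inner_neg_right]
  ring

theorem exists_blockForm_perturbed_solution [CompleteSpace X] {a b : SesqForm D}
    (ha : IsSymmetric a) (hb : IsSymmetric b) (ha0 : IsPosSemidef a) (hb0 : IsPosSemidef b)
    (hab : IsClosedForm (a + b)) (z : WithLp 2 (X × X)) :
    ∃ w : sumDomain D, ∀ y : sumDomain D,
      blockForm a b w y + inner ℂ (y : WithLp 2 (X × X)) (reflection (w : WithLp 2 (X × X)))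
        = inner ℂ (y : WithLp 2 (X × X)) z := by
  -- Here the sum of the two forms is exactly the squared form norm of `a + b`, so `δ = 1`.
  obtain ⟨w₁, w₂, h₁, h₂⟩ := exists_weak_block_solution (a := a + innerForm D) (b := b)
    (ha.add hb) (ha0.add hb0) hab (ha.add isSymmetric_innerForm) hb
    (ha0.add isPosSemidef_innerForm) hb0
    (fun x => by rw [add_self_re, add_self_re, innerForm_self_re]; linarith [hb0 x])
    (fun x => by rw [add_self_re]; nlinarith [ha0 x, sq_nonneg ‖(x : X)‖])
    one_pos
    (fun x => by rw [add_self_re, add_self_re, innerForm_self_re]; linarith)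
    z.fst z.snd
  exact ⟨sumMk w₁ w₂, fun y => by
    rw [← blockForm_add_innerForm]; exact blockForm_eq_inner h₁ h₂ y⟩

theorem exists_blockForm_solution [CompleteSpace X] {a b : SesqForm D}
    (ha : IsSymmetric a) (hb : IsSymmetric b) (ha0 : IsPosSemidef a) (hb0 : IsPosSemidef b)
    (hab : IsClosedForm (a + b)) {m : ℝ} (hm : 0 < m) (hlow : HasLowerBound (a + b) m)
    (z : WithLp 2 (X × X)) :
    ∃ w : sumDomain D, ∀ y : sumDomain D,
      blockForm a b w y = inner ℂ (y : WithLp 2 (X × X)) z := by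
  -- With `t = a + b`, the bound `t ≥ m` is equivalent to `(1 + m) t ≥ m (t + 1)`, whence this `δ`.
  obtain ⟨w₁, w₂, h₁, h₂⟩ := exists_weak_block_solution (a := a) (b := b) (δ := m / (1 + m))
    (ha.add hb) (ha0.add hb0) hab ha hb ha0 hb0
    (fun x => by rw [add_self_re]; nlinarith [hb0 x, sq_nonneg ‖(x : X)‖])
    (fun x => by rw [add_self_re]; nlinarith [ha0 x, sq_nonneg ‖(x : X)‖])
    (by positivity)
    (fun x => by
      rw [div_mul_eq_mul_div, div_le_iff₀ (by positivity), ← add_self_re]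
      linarith [hlow x])
    z.fst z.snd
  exact ⟨sumMk w₁ w₂, blockForm_eq_inner h₁ h₂⟩

/-- The lower bound of an operator represented by the block form. -/
theorem mul_norm_le_of_represents_blockForm {a b : SesqForm D}
    (ha : IsSymmetric a) (hb : IsSymmetric b) {α β : ℝ} (hα : 0 ≤ α) (hβ : 0 ≤ β)
    (haα : HasLowerBound a α) (hbβ : HasLowerBound b β) (hpos : 0 < α ^ 2 + β ^ 2)
    {H : WithLp 2 (X × X) →ₗ.[ℂ] WithLp 2 (X × X)} (hH : Represents (blockForm a b) H)
    (x : H.domain) : √(α ^ 2 + β ^ 2) * ‖(x : WithLp 2 (X × X))‖ ≤ ‖H x‖ := by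
  obtain ⟨hle, hr⟩ := hH
  let w : sumDomain D := ⟨x, hle x.2⟩
  let x₁ := comp₁ D w
  let x₂ := comp₂ D w
  -- The matrix with rows `(α, β)` and `(β, -α)` is `√(α² + β²)` times an orthogonal one; in `Re
  -- h(x, s)` all mixed terms cancel.
  let s : sumDomain D := sumMk ((α : ℂ) • x₁ + (β : ℂ) • x₂) ((β : ℂ) • x₁ - (α : ℂ) • x₂)
  set N := ‖(w : WithLp 2 (X × X))‖ with hN
  have hNsq : N ^ 2 = ‖(x₁ : X)‖ ^ 2 + ‖(x₂ : X)‖ ^ 2 := norm_sq_sumDomain w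
  have hs : ‖(s : WithLp 2 (X × X))‖ = √(α ^ 2 + β ^ 2) * N := by
    rw [← Real.sqrt_sq (norm_nonneg (s : WithLp 2 (X × X))), ← Real.sqrt_sq (show 0 ≤ N from norm_nonneg _),
      ← Real.sqrt_mul hpos.le, hNsq, norm_sq_sumDomain]
    congr 1
    have e₁ : (comp₁ D s : X) = (α : ℂ) • (x₁ : X) + (β : ℂ) • (x₂ : X) := rfl
    have e₂ : (comp₂ D s : X) = (β : ℂ) • (x₁ : X) - (α : ℂ) • (x₂ : X) := rfl
    rw [e₁, e₂, @norm_add_sq ℂ, @norm_sub_sq ℂ]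
    simp only [norm_smul, inner_smul_left, inner_smul_right, Complex.norm_real, mul_pow,
      Real.norm_eq_abs, sq_abs, Complex.conj_ofReal, ← mul_assoc, ← Complex.ofReal_mul,
      RCLike.re_to_complex, Complex.re_ofReal_mul]
    ring
  have hlow : (α ^ 2 + β ^ 2) * N ^ 2 ≤ (blockForm a b w s).re := by
    have e : (blockForm a b w s).re
        = α * ((a x₁ x₁).re + (a x₂ x₂).re) + β * ((b x₁ x₁).re + (b x₂ x₂).re) := by
      have c₁ : (a x₂ x₁).re = (a x₁ x₂).re := by rw [ha, Complex.conj_re]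
      have c₂ : (b x₂ x₁).re = (b x₁ x₂).re := by rw [hb, Complex.conj_re]
      rw [blockForm_apply]
      change (a x₁ ((α : ℂ) • x₁ + (β : ℂ) • x₂) + b x₂ ((α : ℂ) • x₁ + (β : ℂ) • x₂)
        + b x₁ ((β : ℂ) • x₁ - (α : ℂ) • x₂) - a x₂ ((β : ℂ) • x₁ - (α : ℂ) • x₂)).re = _
      simp only [map_add, map_sub, LinearMap.map_smulₛₗ, Complex.conj_ofReal, smul_eq_mul,
        Complex.add_re, Complex.sub_re, Complex.re_ofReal_mul, c₁, c₂]
      ring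
    rw [e, hNsq]
    have h₁ := mul_le_mul_of_nonneg_left (haα x₁) hα
    have h₂ := mul_le_mul_of_nonneg_left (haα x₂) hα
    have h₃ := mul_le_mul_of_nonneg_left (hbβ x₁) hβ
    have h₄ := mul_le_mul_of_nonneg_left (hbβ x₂) hβ
    linarith
  have hup : (blockForm a b w s).re ≤ √(α ^ 2 + β ^ 2) * N * ‖H x‖ := by
    rw [hr x s, ← hs]
    exact (Complex.re_le_norm _).trans (norm_inner_le_norm _ _)
  change √(α ^ 2 + β ^ 2) * N ≤ ‖H x‖
  have hγ : 0 < √(α ^ 2 + β ^ 2) := Real.sqrt_pos.mpr hpos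
  rcases (norm_nonneg (w : WithLp 2 (X × X))).eq_or_lt with h0 | h0
  · rw [hN, ← h0, mul_zero]
    exact norm_nonneg _
  · refine le_of_mul_le_mul_left ?_ (mul_pos hγ h0)
    calc √(α ^ 2 + β ^ 2) * N * (√(α ^ 2 + β ^ 2) * N) = √(α ^ 2 + β ^ 2) ^ 2 * N ^ 2 := by ring
      _ = (α ^ 2 + β ^ 2) * N ^ 2 := by rw [Real.sq_sqrt hpos.le]
      _ ≤ _ := hlow.trans hup

end Block

end BlockForm

theorem mainTheorem5 {X : Type*} [NormedAddCommGroup X] [InnerProductSpace ℂ X] [CompleteSpace X]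
    (D : Submodule ℂ X) (hD : Dense (D : Set X))
    (a b : BlockForm.SesqForm D)
    (ha : BlockForm.IsSymmetric a) (hb : BlockForm.IsSymmetric b)
    (ha0 : BlockForm.IsPosSemidef a) (hb0 : BlockForm.IsPosSemidef b)
    (α β : ℝ) (hα : 0 ≤ α) (hβ : 0 ≤ β)
    (haα : BlockForm.HasLowerBound a α) (hbβ : BlockForm.HasLowerBound b β)
    (hab : BlockForm.IsClosedForm (a + b)) :
    (∃! H : WithLp 2 (X × X) →ₗ.[ℂ] WithLp 2 (X × X),
      IsSelfAdjoint H ∧ BlockForm.Represents (BlockForm.blockForm a b) H) ∧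
    ∀ H : WithLp 2 (X × X) →ₗ.[ℂ] WithLp 2 (X × X),
      IsSelfAdjoint H → BlockForm.Represents (BlockForm.blockForm a b) H →
      (α ≠ 0 ∨ β ≠ 0) →
      ∃ R : WithLp 2 (X × X) →L[ℂ] WithLp 2 (X × X),
        BlockForm.IsBoundedInverse H R ∧ ‖R‖ ≤ 1 / Real.sqrt (α ^ 2 + β ^ 2) := by
  refine ⟨BlockForm.existsUnique_isSelfAdjoint_represents (BlockForm.dense_sumDomain hD)
    (BlockForm.isSymmetric_blockForm ha hb) BlockForm.inner_reflection_left
    (BlockForm.exists_blockForm_perturbed_solution ha hb ha0 hb0 hab), fun H hH hr hne => ?_⟩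
  have hm : 0 < α + β := by
    rcases hne with h | h
    · exact add_pos_of_pos_of_nonneg (hα.lt_of_ne' h) hβ
    · exact add_pos_of_nonneg_of_pos hα (hβ.lt_of_ne' h)
  have hpos : 0 < α ^ 2 + β ^ 2 := by
    rcases hne with h | h <;> positivity
  refine BlockForm.exists_isBoundedInverse H (Real.sqrt_pos.mpr hpos)
    (BlockForm.mul_norm_le_of_represents_blockForm ha hb hα hβ haα hbβ hpos hr) fun z => ?_
  obtain ⟨w, hw⟩ := BlockForm.exists_blockForm_solution ha hb ha0 hb0 hab hm
    (fun x => by rw [BlockForm.add_self_re]; linarith [haα x, hbβ x]) z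
  -- The weak solution lies in the domain of `H` because the graph of `H` is the whole `formGraph`.
  have hmem := BlockForm.mem_formGraph_coe.mpr hw
  rw [← BlockForm.graph_eq_formGraph (BlockForm.isSymmetric_blockForm ha hb) hH hr] at hmem
  obtain ⟨v, -, hv⟩ := LinearPMap.mem_graph_iff H |>.mp hmem
  exact ⟨v, hv⟩
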